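/- Let $n\ge 2$ be an integer. For positive integers $a,b,c$ and a nonzero tensor $S\in\mathbb{C}^a\otimes\mathbb{C}^b\otimes\mathbb{C}^c$, let $S_1\colon\mathbb{C}^a\to\mathbb{C}^b\otimes\mathbb{C}^c$, $S_2\colon\mathbb{C}^b\to\mathbb{C}^a\otimes\mathbb{C}^c$, $S_3\colon\mathbb{C}^c\to\mathbb{C}^a\otimes\mathbb{C}^b$ be its three flattenings, put $\mu_\ell(S)=S_\ell^*S_\ell/\operatorname{Tr}(S_\ell^*S_\ell)$ for $\ell=1,2,3$, and let $$\operatorname{spec}(\mu(S))=\bigl(\operatorname{spec}\mu_1(S),\operatorname{spec}\mu_2(S),\operatorname{spec}\mu_3(S)\bigr)\in\mathbb{R}^a\times\mathbb{R}^b\times\mathbb{R}^c,$$ where $\operatorname{spec}$ of a positive semidefinite matrix is the vector of its eigenvalues, with multiplicity, in non-increasing order. For $W\subseteq\mathbb{C}^a\otimes\mathbb{C}^b\otimes\mathbb{C}^c$ put $\Delta(W)=\{\operatorname{spec}(\mu(S)) : S\in W\setminus\{0\}\}$. The moment polytope of a tensor $T\in\mathbb{C}^a\otimes\mathbb{C}^b\otimes\mathbb{C}^c$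 is $\Delta(T)=\Delta(\overline{\mathrm{GL}\cdot T})$, where $\mathrm{GL}=\mathrm{GL}_a(\mathbb{C})\times\mathrm{GL}_b(\mathbb{C})\times\mathrm{GL}_c(\mathbb{C})$ acts by $(A,B,C)\cdot T=(A\otimes B\otimes C)T$ and the closure is Euclidean; $\Delta(\mathbb{C}^a\otimes\mathbb{C}^b\otimes\mathbb{C}^c)$ is called the Kronecker polytope. Let $$\mathsf{M}_n=\sum_{i,j,k=1}^n e_{i,j}\otimes e_{j,k}\otimes e_{k,i}\in\mathbb{C}^{n^2}\otimes\mathbb{C}^{n^2}\otimes\mathbb{C}^{n^2}$$ be the $n\times n$ matrix multiplication tensor, where $e_{i,j}$ are the standard basis vectors of $\mathbb{C}^{n^2}=\mathbb{C}^{n\times n}$. Then the moment polytope of $\mathsf{M}_n$ is strictly contained in the Kronecker polytope: $$\Delta(\mathsf{M}_n)\subsetneq\Delta(\mathbb{C}^{n^2}\otimes\mathbb{C}^{n^2}\otimes\mathbb{C}^{n^2}).$$ -/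

import Mathlib

open scoped Matrix

noncomputable section

namespace TensorPolytope

/-- The space `ℂ^a ⊗ ℂ^b ⊗ ℂ^c` of `a × b × c` tensors, in the standard basis
`e_i ⊗ e_j ⊗ e_k`. As a finite-dimensional function space it carries the Euclidean topology. -/
abbrev Tensor (a b c : ℕ) : Type := Fin a → Fin b → Fin c → ℂ

/-- The elementary tensor `u ⊗ v ⊗ w`. -/
def elementary {a b c : ℕ} (u : Fin a → ℂ) (v : Fin b → ℂ) (w : Fin c → ℂ) : Tensor a b c :=
  fun i j k => u i * v j * w k

/-- The action `(A ⊗ B ⊗ C) · T` of `GL_a × GL_b × GL_c` by local basis transformations. -/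
def act {a b c : ℕ} (g : GL (Fin a) ℂ × GL (Fin b) ℂ × GL (Fin c) ℂ) (T : Tensor a b c) :
    Tensor a b c :=
  fun i j k => ∑ i', ∑ j', ∑ k',
    (g.1 : Matrix (Fin a) (Fin a) ℂ) i i' * (g.2.1 : Matrix (Fin b) (Fin b) ℂ) j j' *
      (g.2.2 : Matrix (Fin c) (Fin c) ℂ) k k' * T i' j' k'

/-- The `GL`-orbit of a tensor. -/
def orbit {a b c : ℕ} (T : Tensor a b c) : Set (Tensor a b c) :=
  Set.range fun g : GL (Fin a) ℂ × GL (Fin b) ℂ × GL (Fin c) ℂ => act g T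

/-- The matrix of the flattening `T₁ : ℂ^a → ℂ^b ⊗ ℂ^c`. -/
def flattening₁ {a b c : ℕ} (T : Tensor a b c) : Matrix (Fin b × Fin c) (Fin a) ℂ :=
  Matrix.of fun p i => T i p.1 p.2

/-- The matrix of the flattening `T₂ : ℂ^b → ℂ^a ⊗ ℂ^c`. -/
def flattening₂ {a b c : ℕ} (T : Tensor a b c) : Matrix (Fin a × Fin c) (Fin b) ℂ :=
  Matrix.of fun p j => T p.1 j p.2

/-- The matrix of the flattening `T₃ : ℂ^c → ℂ^a ⊗ ℂ^b`. -/
def flattening₃ {a b c : ℕ} (T : Tensor a b c) : Matrix (Fin a × Fin b) (Fin c) ℂ :=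
  Matrix.of fun p k => T p.1 p.2 k

/-- The matrix `A* A / Tr(A* A)`. -/
def normalizedGram {m n : Type*} [Fintype m] [Fintype n] (A : Matrix m n ℂ) : Matrix n n ℂ :=
  (Aᴴ * A).trace⁻¹ • (Aᴴ * A)

theorem normalizedGram_isHermitian {m n : Type*} [Fintype m] [Fintype n] (A : Matrix m n ℂ) :
    (normalizedGram A).IsHermitian := by
  have h : (Aᴴ * A).IsHermitian := Matrix.isHermitian_conjTranspose_mul_self A
  have ht : star (Aᴴ * A).trace = (Aᴴ * A).trace := by
    rw [← Matrix.trace_conjTranspose, h.eq]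
  rw [Matrix.IsHermitian, normalizedGram, Matrix.conjTranspose_smul, star_inv₀, ht, h.eq]

/-- The eigenvalues of a Hermitian matrix, with multiplicity, in non-increasing order. -/
def spec {n : ℕ} {M : Matrix (Fin n) (Fin n) ℂ} (hM : M.IsHermitian) : Fin n → ℝ :=
  fun i => hM.eigenvalues₀ (Fin.cast (Fintype.card_fin n).symm i)

/-- `spec (μ(T)) = (spec μ₁(T) | spec μ₂(T) | spec μ₃(T))`, where `μ = (μ₁, μ₂, μ₃)` with
`μᵢ(T) = Tᵢ* Tᵢ / Tr(Tᵢ* Tᵢ)` is the moment map (meaningful for `T ≠ 0`). -/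
def specMoment {a b c : ℕ} (T : Tensor a b c) : (Fin a → ℝ) × (Fin b → ℝ) × (Fin c → ℝ) :=
  (spec (normalizedGram_isHermitian (flattening₁ T)),
    spec (normalizedGram_isHermitian (flattening₂ T)),
    spec (normalizedGram_isHermitian (flattening₃ T)))

/-- `Δ(W) = { spec (μ(S)) | S ∈ W \ {0} }`. -/
def momentPolytope {a b c : ℕ} (W : Set (Tensor a b c)) :
    Set ((Fin a → ℝ) × (Fin b → ℝ) × (Fin c → ℝ)) :=
  specMoment '' (W \ {0})

/-- The moment polytope of a tensor: that of its (Euclidean) orbit closure. -/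
def tensorMomentPolytope {a b c : ℕ} (T : Tensor a b c) :
    Set ((Fin a → ℝ) × (Fin b → ℝ) × (Fin c → ℝ)) :=
  momentPolytope (closure (orbit T))

/-- The Kronecker polytope `Δ(ℂ^a ⊗ ℂ^b ⊗ ℂ^c)`. -/
def kroneckerPolytope (a b c : ℕ) : Set ((Fin a → ℝ) × (Fin b → ℝ) × (Fin c → ℝ)) :=
  momentPolytope (Set.univ : Set (Tensor a b c))

/-- The standard basis vector `e_{i,j}`: the `m × n` matrix unit at position `(i, j)`, flattened
to a vector along the rows. -/
def matrixUnit {m n : ℕ} (i : Fin m) (j : Fin n) : Fin (m * n) → ℂ :=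
  Pi.single (finProdFinEquiv (i, j)) 1

/-- The matrix multiplication tensor `∑ e_{i,j} ⊗ e_{j,k} ⊗ e_{k,i}`. -/
def matMul (n₁ n₂ n₃ : ℕ) : Tensor (n₁ * n₂) (n₂ * n₃) (n₃ * n₁) :=
  ∑ i : Fin n₁, ∑ j : Fin n₂, ∑ k : Fin n₃,
    elementary (matrixUnit i j) (matrixUnit j k) (matrixUnit k i)

end TensorPolytope

end

open scoped Matrix
noncomputable section
namespace TensorPolytope

/-- Two non-increasing tuples with the same multiset of entries are equal. -/
theorem eq_of_antitone_of_multiset_eq {n : ℕ} {f g : Fin n → ℝ} (hf : Antitone f)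
    (hg : Antitone g) (h : Multiset.map f Finset.univ.val = Multiset.map g Finset.univ.val) :
    f = g := by
  refine List.ofFn_injective (List.Perm.eq_of_sortedGE hf.sortedGE_ofFn hg.sortedGE_ofFn ?_)
  rw [← Multiset.coe_eq_coe]
  simpa [Fin.univ_val_map] using h

theorem spec_antitone {n : ℕ} {M : Matrix (Fin n) (Fin n) ℂ} (hM : M.IsHermitian) :
    Antitone (spec hM) := fun _ _ hij => hM.eigenvalues₀_antitone (by simpa using hij)

theorem roots_charpoly_eq_spec {n : ℕ} {M : Matrix (Fin n) (Fin n) ℂ} (hM : M.IsHermitian) :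
    M.charpoly.roots = Multiset.map (fun i => (spec hM i : ℂ)) Finset.univ.val := by
  rw [hM.roots_charpoly_eq_eigenvalues₀]
  rw [← Finset.map_univ_equiv (finCongr (Fintype.card_fin n).symm), Finset.map_val,
    Multiset.map_map]
  rfl

theorem spec_eq_of_eq_diagonal {n : ℕ} {M : Matrix (Fin n) (Fin n) ℂ} (hM : M.IsHermitian)
    {f : Fin n → ℝ} (hf : Antitone f) (h : M = Matrix.diagonal fun i => (f i : ℂ)) :
    spec hM = f := by
  apply eq_of_antitone_of_multiset_eq (spec_antitone hM) hf
  have h1 := roots_charpoly_eq_spec hM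
  have h2 : M.charpoly.roots = Multiset.map (fun i => (f i : ℂ)) Finset.univ.val := by
    rw [h, Matrix.charpoly_diagonal, Polynomial.roots_prod]
    · simp [Multiset.bind_singleton]
    · exact Finset.prod_ne_zero_iff.2 fun i _ => Polynomial.X_sub_C_ne_zero _
  apply Multiset.map_injective Complex.ofReal_injective
  rw [Multiset.map_map, Multiset.map_map]
  exact h1.symm.trans h2

theorem exists_unitary_diagonalization {n : ℕ} {M : Matrix (Fin n) (Fin n) ℂ}
    (hM : M.IsHermitian) :
    ∃ U : Matrix (Fin n) (Fin n) ℂ, Uᴴ * U = 1 ∧ U * Uᴴ = 1 ∧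
      M = U * Matrix.diagonal (fun i => (spec hM i : ℂ)) * Uᴴ := by
  let e : Fin n ≃ Fin n := (finCongr (Fintype.card_fin n).symm).trans
    (Fintype.equivOfCardEq (Fintype.card_fin _))
  let V : Matrix (Fin n) (Fin n) ℂ := hM.eigenvectorUnitary
  have hV : Vᴴ * V = 1 := Unitary.coe_star_mul_self hM.eigenvectorUnitary
  have hs : ∀ i, hM.eigenvalues (e i) = spec hM i := fun i => by
    simp [e, spec, Matrix.IsHermitian.eigenvalues]
  have hU : (V.submatrix id e)ᴴ * V.submatrix id e = 1 := by
    rw [Matrix.conjTranspose_submatrix,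
      ← Matrix.submatrix_mul _ _ _ _ _ Function.bijective_id, hV, Matrix.submatrix_one_equiv]
  refine ⟨V.submatrix id e, hU, mul_eq_one_comm.1 hU, ?_⟩
  have hd : Matrix.diagonal (fun i => (spec hM i : ℂ)) =
      (Matrix.diagonal fun i => (hM.eigenvalues i : ℂ)).submatrix e e := by
    rw [Matrix.submatrix_diagonal_equiv]
    congr 1; funext i; simp [hs]
  rw [hd, Matrix.conjTranspose_submatrix, Matrix.submatrix_mul_equiv, Matrix.submatrix_mul_equiv,
    Matrix.submatrix_id_id]
  exact hM.spectral_theorem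

theorem sum_norm_sq_eq_dotProduct {m : Type*} [Fintype m] (v : m → ℂ) :
    ((∑ p, ‖v p‖ ^ 2 : ℝ) : ℂ) = star v ⬝ᵥ v := by
  simp [dotProduct, Complex.conj_mul']

theorem trace_gram {m n : Type*} [Fintype m] [Fintype n] (A : Matrix m n ℂ) :
    (Aᴴ * A).trace = ((∑ p, ∑ q, ‖A p q‖ ^ 2 : ℝ) : ℂ) := by
  rw [Finset.sum_comm]
  simp [Matrix.trace, Matrix.mul_apply, Complex.conj_mul']

/-- The spectral decomposition of the squared norm of `A z`. -/
theorem exists_unitary_norm_sq_mulVec {m : Type*} [Fintype m] {n : ℕ} (A : Matrix m (Fin n) ℂ) :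
    ∃ U : Matrix (Fin n) (Fin n) ℂ, Uᴴ * U = 1 ∧ U * Uᴴ = 1 ∧ ∀ z : Fin n → ℂ,
      ∑ p, ‖(A *ᵥ z) p‖ ^ 2 = (∑ p, ∑ q, ‖A p q‖ ^ 2) *
        ∑ l, spec (normalizedGram_isHermitian A) l * ‖(Uᴴ *ᵥ z) l‖ ^ 2 := by
  obtain ⟨U, h1, h2, h3⟩ := exists_unitary_diagonalization (normalizedGram_isHermitian A)
  refine ⟨U, h1, h2, fun z => ?_⟩
  by_cases h0 : (∑ p, ∑ q, ‖A p q‖ ^ 2) = 0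
  · have hA : A = 0 := by
      ext p q
      rw [Finset.sum_eq_zero_iff_of_nonneg (fun _ _ => by positivity)] at h0
      have := h0 p (Finset.mem_univ _)
      rw [Finset.sum_eq_zero_iff_of_nonneg (fun _ _ => by positivity)] at this
      simpa using this q (Finset.mem_univ _)
    simp [hA]
  have hG : Aᴴ * A = (Aᴴ * A).trace • normalizedGram A := by
    have : (Aᴴ * A).trace ≠ 0 := by rw [trace_gram]; exact_mod_cast h0
    rw [normalizedGram, smul_inv_smul₀ this]
  rw [h3, trace_gram] at hG
  apply Complex.ofReal_injective
  rw [sum_norm_sq_eq_dotProduct, Matrix.star_mulVec, ← Matrix.dotProduct_mulVec,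
    Matrix.mulVec_mulVec, hG, Matrix.smul_mulVec, dotProduct_smul,
    ← Matrix.mulVec_mulVec, ← Matrix.mulVec_mulVec, Matrix.dotProduct_mulVec]
  have : star z ᵥ* U = star (Uᴴ *ᵥ z) := by
    rw [Matrix.star_mulVec, Matrix.conjTranspose_conjTranspose]
  rw [this, Complex.ofReal_mul, smul_eq_mul]
  congr 1
  simp only [dotProduct, Matrix.mulVec_diagonal, Complex.ofReal_sum, Complex.ofReal_mul,
    Complex.ofReal_pow, ← Complex.conj_mul', Pi.star_apply, RCLike.star_def]
  exact Finset.sum_congr rfl fun _ _ => by ring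

theorem sum_norm_sq_unitary_mulVec {n : ℕ} {U : Matrix (Fin n) (Fin n) ℂ} (h : U * Uᴴ = 1)
    (z : Fin n → ℂ) : ∑ l, ‖(Uᴴ *ᵥ z) l‖ ^ 2 = ∑ l, ‖z l‖ ^ 2 := by
  apply Complex.ofReal_injective
  rw [sum_norm_sq_eq_dotProduct, sum_norm_sq_eq_dotProduct, Matrix.star_mulVec,
    ← Matrix.dotProduct_mulVec, Matrix.mulVec_mulVec, Matrix.conjTranspose_conjTranspose, h,
    Matrix.one_mulVec]

theorem isClosed_setOf_exists_mem_compact {X Y : Type*} [TopologicalSpace X] [TopologicalSpace Y]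
    {K : Set X} (hK : IsCompact K) {F : Set (X × Y)} (hF : IsClosed F) :
    IsClosed {y | ∃ x ∈ K, (x, y) ∈ F} := by
  have := isCompact_iff_compactSpace.1 hK
  have hc : Continuous fun p : K × Y => ((p.1 : X), p.2) := by fun_prop
  convert isClosedMap_snd_of_compactSpace _ (hF.preimage hc) using 1
  ext y
  simp

/-- A two-dimensional space of complex matrices contains a singular one. -/
theorem exists_singular_combination {n : ℕ} (hn : 0 < n) (X Y : Matrix (Fin n) (Fin n) ℂ) :
    ∃ s t : ℂ, (s, t) ≠ 0 ∧ (s • X + t • Y).det = 0 := by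
  have : NeZero n := ⟨hn.ne'⟩
  by_cases hY : Y.det = 0
  · exact ⟨0, 1, by simp, by simpa using hY⟩
  obtain ⟨c, hc⟩ : (spectrum ℂ (Y⁻¹ * X)).Nonempty :=
    spectrum.nonempty_of_isAlgClosed_of_finiteDimensional ℂ _
  refine ⟨1, -c, by simp, ?_⟩
  rw [spectrum.mem_iff, Matrix.isUnit_iff_isUnit_det, isUnit_iff_ne_zero, not_not] at hc
  have : (1 : ℂ) • X + -c • Y = -(Y * (algebraMap ℂ _ c - Y⁻¹ * X)) := by
    rw [mul_sub, Matrix.mul_nonsing_inv_cancel_left _ _ (isUnit_iff_ne_zero.2 hY),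
      Algebra.algebraMap_eq_smul_one]
    simp
    abel
  rw [this, Matrix.det_neg, Matrix.det_mul, hc]
  simp

/-- The contraction of a tensor with vectors in its first two directions. -/
def contract {a b c : ℕ} (T : Tensor a b c) (x : Fin a → ℂ) (w : Fin b → ℂ) : Fin c → ℂ :=
  fun k => ∑ i, ∑ j, x i * w j * T i j k

theorem contract_act {a b c : ℕ} (g : GL (Fin a) ℂ × GL (Fin b) ℂ × GL (Fin c) ℂ)
    (T : Tensor a b c) (x : Fin a → ℂ) (w : Fin b → ℂ) :
    contract (act g T) x w = (g.2.2 : Matrix (Fin c) (Fin c) ℂ) *ᵥ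
      contract T (x ᵥ* (g.1 : Matrix (Fin a) (Fin a) ℂ))
        (w ᵥ* (g.2.1 : Matrix (Fin b) (Fin b) ℂ)) := by
  obtain ⟨A, B, C⟩ := g
  funext k
  let e : (Fin a × Fin b × Fin a × Fin b × Fin c) ≃ (Fin c × Fin a × Fin b × Fin b × Fin a) :=
    { toFun := fun p => (p.2.2.2.2, p.2.2.1, p.2.2.2.1, p.2.1, p.1)
      invFun := fun p => (p.2.2.2.2, p.2.2.2.1, p.2.1, p.2.2.1, p.1)
      left_inv := fun _ => rfl
      right_inv := fun _ => rfl }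
  have h := Fintype.sum_equiv e
    (fun p => x p.1 * w p.2.1 * ((A : Matrix (Fin a) (Fin a) ℂ) p.1 p.2.2.1 *
      (B : Matrix (Fin b) (Fin b) ℂ) p.2.1 p.2.2.2.1 *
      (C : Matrix (Fin c) (Fin c) ℂ) k p.2.2.2.2 * T p.2.2.1 p.2.2.2.1 p.2.2.2.2))
    (fun p => (C : Matrix (Fin c) (Fin c) ℂ) k p.1 * (x p.2.2.2.2 *
      (A : Matrix (Fin a) (Fin a) ℂ) p.2.2.2.2 p.2.1 * (w p.2.2.2.1 *
      (B : Matrix (Fin b) (Fin b) ℂ) p.2.2.2.1 p.2.2.1) * T p.2.1 p.2.2.1 p.1))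
    (fun _ => by simp only [e, Equiv.coe_fn_mk]; ring)
  simp only [Fintype.sum_prod_type] at h
  simpa only [contract, act, Matrix.mulVec, Matrix.vecMul, dotProduct, Finset.mul_sum,
    Finset.sum_mul] using h

theorem contract_matMul {n₁ n₂ n₃ : ℕ} (x : Fin (n₁ * n₂) → ℂ) (w : Fin (n₂ * n₃) → ℂ)
    (k : Fin n₃) (i : Fin n₁) :
    contract (matMul n₁ n₂ n₃) x w (finProdFinEquiv (k, i)) =
      ∑ j, x (finProdFinEquiv (i, j)) * w (finProdFinEquiv (j, k)) := by
  simp only [contract, matMul, elementary, matrixUnit, Finset.sum_apply]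
  rw [← finProdFinEquiv.sum_comp]
  simp_rw [← finProdFinEquiv.sum_comp (fun j => _ * w j * _)]
  simp [Pi.single_apply, Fintype.sum_prod_type, Finset.mul_sum, ite_and]

/-- Every two-dimensional space of slices of a tensor in the orbit of `M_n` contains a matrix with
a kernel vector orthogonal to a given vector. -/
theorem exists_contract_eq_zero_of_mem_orbit {n : ℕ} (hn : 2 ≤ n)
    {T : Tensor (n * n) (n * n) (n * n)} (hT : T ∈ orbit (matMul n n n))
    (x y v : Fin (n * n) → ℂ) :
    ∃ p : ℂ × ℂ, p ≠ 0 ∧ ∃ w : Fin (n * n) → ℂ, w ≠ 0 ∧ v ⬝ᵥ w = 0 ∧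
      contract T (p.1 • x + p.2 • y) w = 0 := by
  obtain ⟨g, rfl⟩ := hT
  let B : Matrix (Fin (n * n)) (Fin (n * n)) ℂ := g.2.1
  let mat : (Fin (n * n) → ℂ) → Matrix (Fin n) (Fin n) ℂ := fun z =>
    Matrix.of fun a b => (z ᵥ* (g.1 : Matrix (Fin (n * n)) (Fin (n * n)) ℂ)) (finProdFinEquiv (a, b))
  obtain ⟨s, t, hst, hdet⟩ := exists_singular_combination (by omega) (mat x) (mat y)
  obtain ⟨u, hu, hXu⟩ := Matrix.exists_mulVec_eq_zero_iff.2 hdet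
  have hB : IsUnit B.det := (Matrix.isUnit_iff_isUnit_det _).1 g.2.1.isUnit
  let W : (Fin n → ℂ) →ₗ[ℂ] (Fin (n * n) → ℂ) :=
    { toFun := fun z p => u (finProdFinEquiv.symm p).1 * z (finProdFinEquiv.symm p).2
      map_add' := fun _ _ => by funext; simp [mul_add]
      map_smul' := fun _ _ => by funext; simp [mul_left_comm] }
  let φ : (Fin n → ℂ) →ₗ[ℂ] ℂ := (dotProductBilin ℂ ℂ v) ∘ₗ (Matrix.vecMulLinear B⁻¹) ∘ₗ W
  obtain ⟨z, hz, hz0⟩ : ∃ z ∈ LinearMap.ker φ, z ≠ 0 := by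
    rw [← Submodule.ne_bot_iff]
    refine LinearMap.ker_ne_bot_of_finrank_lt ?_
    simp; omega
  have hWB : (W z ᵥ* B⁻¹) ᵥ* B = W z := by
    rw [Matrix.vecMul_vecMul, Matrix.nonsing_inv_mul _ hB, Matrix.vecMul_one]
  refine ⟨(s, t), hst, W z ᵥ* B⁻¹, ?_, hz, ?_⟩
  · intro h0
    rw [h0, Matrix.zero_vecMul] at hWB
    obtain ⟨a, ha⟩ := Function.ne_iff.1 hu
    obtain ⟨c, hc⟩ := Function.ne_iff.1 hz0
    have := congrFun hWB (finProdFinEquiv (a, c))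
    simp only [W, LinearMap.coe_mk, AddHom.coe_mk, Equiv.symm_apply_apply, Pi.zero_apply] at this
    exact mul_ne_zero ha hc this.symm
  · rw [contract_act]
    change _ *ᵥ contract _ _ ((W z ᵥ* B⁻¹) ᵥ* B) = 0
    rw [hWB]
    suffices h : contract (matMul n n n) ((s • x + t • y) ᵥ* (g.1 : Matrix _ _ ℂ)) (W z) = 0 by
      rw [h, Matrix.mulVec_zero]
    funext q
    obtain ⟨⟨k, i⟩, rfl⟩ := finProdFinEquiv.surjective q
    rw [contract_matMul]
    have := congrFun hXu i
    simp only [Matrix.mulVec, dotProduct, mat, Matrix.add_apply, Matrix.smul_apply, Matrix.of_apply,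
      Pi.zero_apply, smul_eq_mul] at this
    simp only [W, LinearMap.coe_mk, AddHom.coe_mk, Equiv.symm_apply_apply, ← mul_assoc,
      ← Finset.sum_mul, Matrix.add_vecMul, Matrix.smul_vecMul, Pi.add_apply, Pi.smul_apply,
      smul_eq_mul, this, zero_mul, Pi.zero_apply]

theorem exists_contract_eq_zero_of_mem_closure_orbit {n : ℕ} (hn : 2 ≤ n)
    {S : Tensor (n * n) (n * n) (n * n)} (hS : S ∈ closure (orbit (matMul n n n)))
    (x y v : Fin (n * n) → ℂ) :
    ∃ p : ℂ × ℂ, p ≠ 0 ∧ ∃ w : Fin (n * n) → ℂ, w ≠ 0 ∧ v ⬝ᵥ w = 0 ∧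
      contract S (p.1 • x + p.2 • y) w = 0 := by
  let K : Set ((ℂ × ℂ) × (Fin (n * n) → ℂ)) := Metric.sphere 0 1 ×ˢ Metric.sphere 0 1
  let F : Set (((ℂ × ℂ) × (Fin (n * n) → ℂ)) × Tensor (n * n) (n * n) (n * n)) :=
    {q | v ⬝ᵥ q.1.2 = 0 ∧ contract q.2 (q.1.1.1 • x + q.1.1.2 • y) q.1.2 = 0}
  have hK : IsCompact K := (isCompact_sphere _ _).prod (isCompact_sphere _ _)
  have hF : IsClosed F := by
    refine (isClosed_eq ?_ continuous_const).inter (isClosed_eq ?_ continuous_const)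
    · unfold dotProduct; fun_prop
    · unfold contract
      simp only [Pi.add_apply, Pi.smul_apply, smul_eq_mul]
      fun_prop
  have hsub : orbit (matMul n n n) ⊆ {T | ∃ q ∈ K, (q, T) ∈ F} := by
    intro T hT
    obtain ⟨p, hp, w, hw, h1, h2⟩ := exists_contract_eq_zero_of_mem_orbit hn hT x y v
    have hp' : (‖p‖ : ℂ) ≠ 0 := by simpa using hp
    have hw' : (‖w‖ : ℂ) ≠ 0 := by simpa using hw
    refine ⟨((‖p‖ : ℂ)⁻¹ • p, (‖w‖ : ℂ)⁻¹ • w), ⟨?_, ?_⟩, ?_, ?_⟩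
    · rw [mem_sphere_zero_iff_norm]
      exact norm_smul_inv_norm hp
    · rw [mem_sphere_zero_iff_norm]
      exact norm_smul_inv_norm hw
    · simp [dotProduct_smul, h1]
    · funext k
      have := congrFun h2 k
      simp only [contract, Prod.smul_fst, Prod.smul_snd, Pi.add_apply, Pi.smul_apply, smul_eq_mul,
        Pi.zero_apply] at this ⊢
      calc _ = (‖p‖ : ℂ)⁻¹ * (‖w‖ : ℂ)⁻¹ *
            ∑ i, ∑ j, (p.1 * x i + p.2 * y i) * w j * T i j k := by
            simp only [Finset.mul_sum]
            exact Finset.sum_congr rfl fun i _ => Finset.sum_congr rfl fun j _ => by ring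
        _ = 0 := by rw [this, mul_zero]
  obtain ⟨q, ⟨hq1, hq2⟩, h1, h2⟩ :=
    closure_minimal hsub (isClosed_setOf_exists_mem_compact hK hF) hS
  exact ⟨q.1, ne_zero_of_mem_unit_sphere ⟨q.1, hq1⟩, q.2,
    ne_zero_of_mem_unit_sphere ⟨q.2, hq2⟩, h1, h2⟩

/-- A vector whose contraction with `S` has rank at most one is zero, provided that `S` restricted
to the orthogonal complement of `v` is large in the second direction compared to the third one. -/
theorem eq_zero_of_contraction_rank_one {a b c : ℕ} {S : Tensor a b c} {α β : ℝ}
    (hβ : 0 ≤ β) (hαβ : β < α)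
    (h3 : ∀ z, ∑ p, ‖(flattening₃ S *ᵥ z) p‖ ^ 2 = β * ∑ k, ‖z k‖ ^ 2)
    {w : Fin b → ℂ} (h2 : ∑ p, ‖(flattening₂ S *ᵥ w) p‖ ^ 2 = α * ∑ j, ‖w j‖ ^ 2)
    {y : Fin a → ℂ} {r : Fin c → ℂ} (hG : ∀ p, (flattening₂ S *ᵥ w) p = y p.1 * r p.2) :
    w = 0 := by
  set Y := ∑ i, ‖y i‖ ^ 2 with hY
  set R := ∑ k, ‖r k‖ ^ 2 with hR
  set X := ∑ j, ‖w j‖ ^ 2 with hX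
  have hYn : 0 ≤ Y := by positivity
  have hRn : 0 ≤ R := by positivity
  have hXn : 0 ≤ X := by positivity
  have hYR : Y * R = α * X := by
    rw [← h2, hY, hR, Finset.sum_mul_sum, Fintype.sum_prod_type]
    simp [hG, mul_pow]
  have hpair : ((Y * R : ℝ) : ℂ) =
      ∑ j, w j * ∑ i, star (y i) * (flattening₃ S *ᵥ star r) (i, j) := by
    have h1 : ((Y * R : ℝ) : ℂ) =
        ∑ i, ∑ k, star (y i) * star (r k) * (flattening₂ S *ᵥ w) (i, k) := by
      rw [hY, hR, Complex.ofReal_mul, Complex.ofReal_sum, Complex.ofReal_sum, Finset.sum_mul_sum]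
      refine Finset.sum_congr rfl fun i _ => Finset.sum_congr rfl fun k _ => ?_
      rw [hG, Complex.ofReal_pow, Complex.ofReal_pow, ← Complex.conj_mul', ← Complex.conj_mul']
      simp only [RCLike.star_def]; ring
    rw [h1]
    simp only [flattening₂, flattening₃, Matrix.mulVec, dotProduct, Matrix.of_apply,
      Finset.mul_sum, Pi.star_apply]
    rw [Finset.sum_comm' (t' := Finset.univ) (s' := fun _ => Finset.univ) (by simp)]
    rw [Finset.sum_congr rfl fun k _ => Finset.sum_comm, Finset.sum_comm]
    refine Finset.sum_congr rfl fun j _ => ?_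
    rw [Finset.sum_comm]
    exact Finset.sum_congr rfl fun i _ => Finset.sum_congr rfl fun k _ => by ring
  have hbound : (Y * R) ^ 2 ≤ X * (Y * (β * R)) := by
    have hn : Y * R = ‖((Y * R : ℝ) : ℂ)‖ := by
      rw [Complex.norm_real, Real.norm_of_nonneg (by positivity)]
    have hR' : R = ∑ k, ‖star r k‖ ^ 2 := by simp [hR]
    rw [hn, hpair]
    calc _ ≤ (∑ j, ‖w j‖ * ‖∑ i, star (y i) * (flattening₃ S *ᵥ star r) (i, j)‖) ^ 2 := by
          gcongr
          refine (norm_sum_le _ _).trans_eq ?_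
          simp only [norm_mul]
      _ ≤ X * ∑ j, ‖∑ i, star (y i) * (flattening₃ S *ᵥ star r) (i, j)‖ ^ 2 :=
          Finset.sum_mul_sq_le_sq_mul_sq _ _ _
      _ ≤ X * ∑ j, Y * ∑ i, ‖(flattening₃ S *ᵥ star r) (i, j)‖ ^ 2 := by
          gcongr with j
          calc _ ≤ (∑ i, ‖y i‖ * ‖(flattening₃ S *ᵥ star r) (i, j)‖) ^ 2 := by
                gcongr
                refine (norm_sum_le _ _).trans_eq ?_
                simp only [norm_mul, norm_star]
            _ ≤ _ := Finset.sum_mul_sq_le_sq_mul_sq _ _ _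
      _ = X * (Y * (β * R)) := by
          rw [hR', ← h3, Fintype.sum_prod_type, ← Finset.mul_sum, Finset.sum_comm]
  have hX0 : X = 0 := by
    by_contra hne
    have hXp : 0 < X := lt_of_le_of_ne hXn (Ne.symm hne)
    have hα : 0 < α := hβ.trans_lt hαβ
    rw [hYR, show X * (Y * (β * R)) = X * β * (Y * R) by ring, hYR, sq] at hbound
    have h5 := le_of_mul_le_mul_right hbound (by positivity)
    rw [mul_comm X] at h5
    exact absurd (le_of_mul_le_mul_right h5 hXp) (not_le.2 hαβ)
  rw [hX, Finset.sum_eq_zero_iff_of_nonneg fun _ _ => by positivity] at hX0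
  funext j
  simpa using hX0 j (Finset.mem_univ j)

/-- The triple of uniform spectra with `2`, `N - 1` and `N` nonzero entries. -/
def uniformPoint (N : ℕ) : (Fin N → ℝ) × (Fin N → ℝ) × (Fin N → ℝ) :=
  (fun i => if i.val < 2 then 2⁻¹ else 0, fun j => if j.val + 1 < N then ((N : ℝ) - 1)⁻¹ else 0,
    fun _ => (N : ℝ)⁻¹)

/-- If every pencil of slices of `S` contains a matrix with a kernel vector orthogonal to any given
vector, then the spectra of `S` are not the uniform ones of ranks `2`, `N - 1`, `N`. -/
theorem specMoment_ne_uniformPoint {N : ℕ} (hN : 2 ≤ N) {S : Tensor N N N} (h0 : S ≠ 0)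
    (hS : ∀ x y v : Fin N → ℂ, ∃ p : ℂ × ℂ, p ≠ 0 ∧ ∃ w : Fin N → ℂ, w ≠ 0 ∧ v ⬝ᵥ w = 0 ∧
      contract S (p.1 • x + p.2 • y) w = 0) :
    specMoment S ≠ uniformPoint N := by
  intro h
  have hN' : (2 : ℝ) ≤ N := by exact_mod_cast hN
  simp only [specMoment, uniformPoint, Prod.mk.injEq] at h
  obtain ⟨hs1, hs2, hs3⟩ := h
  obtain ⟨U₁, hU₁', hU₁, hq1⟩ := exists_unitary_norm_sq_mulVec (flattening₁ S)
  obtain ⟨U₂, -, hU₂, hq2⟩ := exists_unitary_norm_sq_mulVec (flattening₂ S)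
  obtain ⟨U₃, -, hU₃, hq3⟩ := exists_unitary_norm_sq_mulVec (flattening₃ S)
  rw [hs1] at hq1
  rw [hs2] at hq2
  rw [hs3] at hq3
  set τ := ∑ i, ∑ j, ∑ k, ‖S i j k‖ ^ 2 with hτ
  have hτ2 : ∑ p, ∑ q, ‖flattening₂ S p q‖ ^ 2 = τ := by
    rw [Fintype.sum_prod_type]
    exact Finset.sum_congr rfl fun i _ => Finset.sum_comm
  have hτ3 : ∑ p, ∑ q, ‖flattening₃ S p q‖ ^ 2 = τ := by
    rw [Fintype.sum_prod_type]; rfl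
  have hτpos : 0 < τ := by
    obtain ⟨i, hi⟩ := Function.ne_iff.1 h0
    obtain ⟨j, hj⟩ := Function.ne_iff.1 hi
    obtain ⟨k, hk⟩ := Function.ne_iff.1 hj
    refine Finset.sum_pos' (fun _ _ => by positivity) ⟨i, Finset.mem_univ _, ?_⟩
    refine Finset.sum_pos' (fun _ _ => by positivity) ⟨j, Finset.mem_univ _, ?_⟩
    refine Finset.sum_pos' (fun _ _ => by positivity) ⟨k, Finset.mem_univ _, ?_⟩
    have : 0 < ‖S i j k‖ := norm_pos_iff.2 hk
    positivity
  let i₀ : Fin N := ⟨0, by omega⟩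
  let i₁ : Fin N := ⟨1, by omega⟩
  let last : Fin N := ⟨N - 1, by omega⟩
  obtain ⟨p, hp, w, hw, hvw, hc⟩ := hS (U₁.col i₀) (U₁.col i₁) (U₂ᴴ.row last)
  have hcol : ∀ l, contract S (U₁.col l) w = U₁.col l ᵥ* Matrix.of fun i k =>
      (flattening₂ S *ᵥ w) (i, k) := by
    intro l
    funext k
    simp only [contract, Matrix.vecMul, Matrix.mulVec, dotProduct, flattening₂, Finset.mul_sum,
      Matrix.of_apply]
    exact Finset.sum_congr rfl fun i _ => Finset.sum_congr rfl fun j _ => by ring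
  have hzero : ∀ l : Fin N, 2 ≤ l.val → contract S (U₁.col l) w = 0 := by
    intro l hl
    have h1 : flattening₁ S *ᵥ U₁.col l = 0 := by
      have hsingle : U₁ᴴ *ᵥ U₁.col l = Pi.single l 1 := by
        rw [← Matrix.mulVec_single_one U₁, Matrix.mulVec_mulVec, hU₁', Matrix.one_mulVec]
      have hsum := hq1 (U₁.col l)
      rw [hsingle, Finset.sum_eq_zero (s := Finset.univ (α := Fin N)), mul_zero,
        Finset.sum_eq_zero_iff_of_nonneg fun _ _ => by positivity] at hsum
      · funext q
        simpa using hsum q (Finset.mem_univ q)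
      · intro m _
        by_cases hm : m = l
        · simp [hm, not_lt.2 hl]
        · simp [hm]
    funext k
    have h2 : ∀ j, ∑ i, S i j k * U₁ i l = 0 := fun j => congrFun h1 (j, k)
    simp only [contract, Matrix.col_apply, Pi.zero_apply]
    rw [Finset.sum_comm]
    refine Finset.sum_eq_zero fun j _ => ?_
    rw [← mul_zero (w j), ← h2 j, Finset.mul_sum]
    exact Finset.sum_congr rfl fun _ _ => by ring
  have hexp : ∀ i k, (flattening₂ S *ᵥ w) (i, k) = star (U₁ i i₀) * contract S (U₁.col i₀) w k +
      star (U₁ i i₁) * contract S (U₁.col i₁) w k := by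
    intro i k
    have h1 : (flattening₂ S *ᵥ w) (i, k) =
        ∑ l, star (U₁ i l) * contract S (U₁.col l) w k := by
      let G : Matrix (Fin N) (Fin N) ℂ := Matrix.of fun i k => (flattening₂ S *ᵥ w) (i, k)
      have hU : U₁.map star * U₁ᵀ = 1 := by
        have := congrArg Matrix.transpose hU₁
        rwa [Matrix.transpose_mul, Matrix.transpose_one] at this
      have h2 : G = U₁.map star * (U₁ᵀ * G) := by rw [← Matrix.mul_assoc, hU, Matrix.one_mul]
      have h3 := congrFun (congrFun h2 i) k
      rw [Matrix.mul_apply] at h3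
      refine h3.trans (Finset.sum_congr rfl fun l _ => ?_)
      rw [hcol]
      rfl
    rw [h1, Fintype.sum_eq_add i₀ i₁ (by simp [i₀, i₁])]
    rintro l ⟨hl0, hl1⟩
    rw [hzero l, Pi.zero_apply, mul_zero]
    have h2 : l.val ≠ 0 := fun h => hl0 (Fin.ext h)
    have h3 : l.val ≠ 1 := fun h => hl1 (Fin.ext h)
    omega
  obtain ⟨y, r, hyr⟩ : ∃ (y r : Fin N → ℂ), ∀ q, (flattening₂ S *ᵥ w) q = y q.1 * r q.2 := by
    have hc' : ∀ k, p.1 * contract S (U₁.col i₀) w k + p.2 * contract S (U₁.col i₁) w k = 0 := by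
      intro k
      have := congrFun hc k
      simp only [contract, Pi.add_apply, Pi.smul_apply, smul_eq_mul, Pi.zero_apply] at this ⊢
      rw [← this]
      simp only [Finset.mul_sum, ← Finset.sum_add_distrib]
      exact Finset.sum_congr rfl fun i _ => Finset.sum_congr rfl fun j _ => by ring
    by_cases hp1 : p.1 = 0
    · have hp2 : p.2 ≠ 0 := fun h => hp (Prod.ext hp1 h)
      refine ⟨fun i => star (U₁ i i₀), contract S (U₁.col i₀) w, fun ⟨i, k⟩ => ?_⟩
      have := hc' k
      rw [hp1, zero_mul, zero_add, mul_eq_zero, or_iff_right hp2] at this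
      rw [hexp, this, mul_zero, add_zero]
    · refine ⟨fun i => star (U₁ i i₁) - p.2 / p.1 * star (U₁ i i₀), contract S (U₁.col i₁) w,
        fun ⟨i, k⟩ => ?_⟩
      have : contract S (U₁.col i₀) w k = -(p.2 / p.1 * contract S (U₁.col i₁) w k) := by
        have := hc' k
        field_simp
        linear_combination this
      rw [hexp, this]
      ring
  refine hw (eq_zero_of_contraction_rank_one (α := τ * ((N : ℝ) - 1)⁻¹)
    (β := τ * (N : ℝ)⁻¹) (by positivity) ?_ (fun z => ?_) ?_ hyr)
  · exact mul_lt_mul_of_pos_left (inv_strictAnti₀ (by linarith) (by linarith)) hτpos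
  · rw [hq3, hτ3, ← Finset.mul_sum, sum_norm_sq_unitary_mulVec hU₃, mul_assoc]
  · rw [hq2, hτ2, ← sum_norm_sq_unitary_mulVec hU₂, mul_assoc, Finset.mul_sum _ _ ((_ : ℝ)⁻¹)]
    congr 1
    refine Finset.sum_congr rfl fun l _ => ?_
    beta_reduce
    split_ifs with hl
    · rfl
    · have : l = last := Fin.ext (by simp only [last]; omega)
      have h0 : (U₂ᴴ *ᵥ w) l = 0 := by rw [this]; exact hvw
      simp [h0]

theorem normalizedGram_eq_diagonal {m : Type*} [Fintype m] {N : ℕ} {A : Matrix m (Fin N) ℂ}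
    {d : Fin N → ℝ} {τ : ℝ} (hoff : ∀ k k', k ≠ k' → ∀ p, A p k = 0 ∨ A p k' = 0)
    (hd : ∀ k, ∑ p, ‖A p k‖ ^ 2 = d k) (hτ : ∑ k, d k = τ) :
    normalizedGram A = Matrix.diagonal fun k => ((τ⁻¹ * d k : ℝ) : ℂ) := by
  have ht : (Aᴴ * A).trace = (τ : ℂ) := by
    rw [trace_gram, Finset.sum_comm, ← hτ]
    simp only [hd]
  ext k k'
  rw [normalizedGram, ht, Matrix.smul_apply, Matrix.mul_apply, Matrix.diagonal_apply]
  split_ifs with h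
  · subst h
    rw [← hd k]
    simp [Complex.conj_mul']
  · rw [Finset.sum_eq_zero, smul_zero]
    intro p _
    rcases hoff k k' h p with h | h <;> simp [h]

/-- A balanced `2 × (N - 1) × N` Kronecker block. -/
def kroneckerBlock (N : ℕ) : Tensor N N N := fun i j k =>
  if i.val = 0 ∧ k = j then (√((N : ℝ) - 1 - k.val) : ℂ)
  else if i.val = 1 ∧ k.val = j.val + 1 then (√(k.val : ℝ) : ℂ) else 0

theorem norm_sq_kroneckerBlock {N : ℕ} (i j k : Fin N) :
    ‖kroneckerBlock N i j k‖ ^ 2 = (if i.val = 0 then if k = j then (N : ℝ) - 1 - k.val else 0 else 0)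
      + (if i.val = 1 then if k.val = j.val + 1 then (k.val : ℝ) else 0 else 0) := by
  have hk : (0 : ℝ) ≤ (N : ℝ) - 1 - k.val := by
    have : ((k.val + 1 : ℕ) : ℝ) ≤ N := by exact_mod_cast k.isLt
    push_cast at this
    linarith
  unfold kroneckerBlock
  by_cases h0 : i.val = 0
  · by_cases hkj : k = j <;> simp [h0, hkj, Complex.norm_real]
    subst hkj
    exact Real.sq_sqrt hk
  · by_cases h1 : i.val = 1
    · by_cases hkj : k.val = j.val + 1
      · simp [h1, hkj, Complex.norm_real]
        rw [Real.sq_sqrt]; positivity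
      · simp [h1, hkj]
    · simp [h0, h1]

theorem sum_ite_val_eq {N c : ℕ} (f : Fin N → ℝ) :
    (∑ i : Fin N, if i.val = c then f i else 0) = if h : c < N then f ⟨c, h⟩ else 0 := by
  split_ifs with h
  · rw [Finset.sum_eq_single ⟨c, h⟩] <;> simp [Fin.ext_iff]
    intro b h1 h2; exact absurd h2 h1
  · refine Finset.sum_eq_zero fun i _ => if_neg fun hi => h (by omega)

theorem sum_range_val (N : ℕ) : ∑ k : Fin N, (k.val : ℝ) = N * (N - 1) / 2 := by
  rw [Fin.sum_univ_eq_sum_range fun k => (k : ℝ)]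
  induction N with
  | zero => simp
  | succ m ih => rw [Finset.sum_range_succ, ih]; push_cast; ring

theorem sum_ite_eq_val_add_one {N : ℕ} (k : Fin N) :
    (∑ j : Fin N, if k.val = j.val + 1 then (k.val : ℝ) else 0) = k.val := by
  obtain ⟨k, hk⟩ := k
  rcases k with _ | k
  · simp
  · have := sum_ite_val_eq (N := N) (c := k) fun _ => ((k + 1 : ℕ) : ℝ)
    rw [dif_pos (by omega)] at this
    refine Eq.trans ?_ this
    exact Finset.sum_congr rfl fun j _ => by simp [eq_comm]

theorem specMoment_kroneckerBlock {N : ℕ} (hN : 2 ≤ N) :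
    specMoment (kroneckerBlock N) = uniformPoint N := by
  have hN' : (2 : ℝ) ≤ N := by exact_mod_cast hN
  have hN1 : (N : ℝ) - 1 ≠ 0 := by linarith
  have hN0 : (N : ℝ) ≠ 0 := by linarith
  have h0 : 0 < N := by omega
  have h1 : 1 < N := by omega
  have hg1 := normalizedGram_eq_diagonal (A := flattening₁ (kroneckerBlock N))
    (d := fun i => if i.val < 2 then N * (N - 1) / 2 else 0) (τ := N * (N - 1))
    (by
      rintro i i' hii ⟨j, k⟩
      simp only [flattening₁, Matrix.of_apply, kroneckerBlock, Fin.ext_iff] at hii ⊢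
      grind)
    (by
      intro i
      simp only [flattening₁, Matrix.of_apply, norm_sq_kroneckerBlock, Fintype.sum_prod_type,
        Finset.sum_add_distrib]
      by_cases hi0 : i.val = 0
      · simp [hi0, Finset.sum_sub_distrib, sum_range_val]
        ring
      by_cases hi1 : i.val = 1
      · simp only [hi1, if_true, one_ne_zero, if_false, Finset.sum_const_zero, zero_add]
        rw [Finset.sum_comm]
        simp [sum_ite_eq_val_add_one, sum_range_val]
      · rw [if_neg (by omega)]
        simp [hi0, hi1])
    (by
      have : ∀ i : Fin N, (if i.val < 2 then (N * (N - 1) / 2 : ℝ) else 0) =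
          (if i.val = 0 then (N * (N - 1) / 2 : ℝ) else 0) +
            if i.val = 1 then (N * (N - 1) / 2 : ℝ) else 0 := by
        intro i
        split_ifs <;> first | omega | simp
      simp only [this, Finset.sum_add_distrib, sum_ite_val_eq, h0, h1, dif_pos]
      ring)
  have hg2 := normalizedGram_eq_diagonal (A := flattening₂ (kroneckerBlock N))
    (d := fun j => if j.val + 1 < N then (N : ℝ) else 0) (τ := N * (N - 1))
    (by
      rintro i i' hii ⟨j, k⟩
      simp only [flattening₂, Matrix.of_apply, kroneckerBlock, Fin.ext_iff] at hii ⊢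
      grind)
    (by
      intro j
      simp only [flattening₂, Matrix.of_apply, norm_sq_kroneckerBlock, Fintype.sum_prod_type]
      rw [Finset.sum_comm]
      simp only [Finset.sum_add_distrib, sum_ite_val_eq, h0, h1, dif_pos,
        Finset.sum_ite_eq', Finset.mem_univ, if_true]
      split_ifs with h
      · push_cast; ring
      · have : j.val = N - 1 := by omega
        rw [this]; push_cast [h0.nat_succ_le]; ring)
    (by
      have : ∀ j : Fin N, (if j.val + 1 < N then (N : ℝ) else 0) =
          N - if j.val = N - 1 then (N : ℝ) else 0 := by
        intro j
        split_ifs <;> first | omega | simp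
      simp only [this, Finset.sum_sub_distrib, sum_ite_val_eq, Nat.sub_lt h0, zero_lt_one, dif_pos]
      simp
      ring)
  have hg3 := normalizedGram_eq_diagonal (A := flattening₃ (kroneckerBlock N))
    (d := fun _ => (N : ℝ) - 1) (τ := N * (N - 1))
    (by
      rintro i i' hii ⟨j, k⟩
      simp only [flattening₃, Matrix.of_apply, kroneckerBlock, Fin.ext_iff] at hii ⊢
      grind)
    (by
      intro k
      simp only [flattening₃, Matrix.of_apply, norm_sq_kroneckerBlock, Fintype.sum_prod_type]
      rw [Finset.sum_comm]
      simp only [Finset.sum_add_distrib, sum_ite_val_eq, h0, h1, dif_pos,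
        Finset.sum_ite_eq, Finset.mem_univ, if_true,
        sum_ite_eq_val_add_one]
      ring)
    (by simp; ring)
  refine Prod.ext ?_ (Prod.ext ?_ ?_)
  · refine (spec_eq_of_eq_diagonal (normalizedGram_isHermitian _) ?_ hg1).trans ?_
    · intro i j hij
      have hij' : i.val ≤ j.val := hij
      refine mul_le_mul_of_nonneg_left ?_ (inv_nonneg.2 (by nlinarith))
      split_ifs <;> first | omega | nlinarith
    · funext i
      simp only [uniformPoint]
      split_ifs
      · field_simp
      · simp
  · refine (spec_eq_of_eq_diagonal (normalizedGram_isHermitian _) ?_ hg2).trans ?_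
    · intro i j hij
      have hij' : i.val ≤ j.val := hij
      refine mul_le_mul_of_nonneg_left ?_ (inv_nonneg.2 (by nlinarith))
      split_ifs <;> first | omega | nlinarith
    · funext i
      simp only [uniformPoint]
      split_ifs
      · field_simp
      · simp
  · refine (spec_eq_of_eq_diagonal (normalizedGram_isHermitian _) antitone_const hg3).trans ?_
    funext i
    simp only [uniformPoint]
    field_simp

theorem kroneckerBlock_ne_zero {N : ℕ} (hN : 2 ≤ N) : kroneckerBlock N ≠ 0 := by
  intro h
  have h1 := norm_sq_kroneckerBlock (N := N) ⟨1, hN⟩ ⟨0, by omega⟩ ⟨1, hN⟩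
  rw [h] at h1
  simp at h1

end TensorPolytope

end

theorem corollary1p3 (n : ℕ) (hn : 2 ≤ n) :
    TensorPolytope.tensorMomentPolytope (TensorPolytope.matMul n n n) ⊂
      TensorPolytope.kroneckerPolytope (n * n) (n * n) (n * n) := by
  have hN : 2 ≤ n * n := hn.trans (Nat.le_mul_self n)
  refine (Set.ssubset_iff_of_subset
    (Set.image_mono (Set.sdiff_subset_sdiff_left (Set.subset_univ _)))).2
    ⟨TensorPolytope.uniformPoint (n * n), ⟨TensorPolytope.kroneckerBlock (n * n),
      ⟨Set.mem_univ _, TensorPolytope.kroneckerBlock_ne_zero hN⟩,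
      TensorPolytope.specMoment_kroneckerBlock hN⟩, ?_⟩
  rintro ⟨S, ⟨hS, h0⟩, h⟩
  exact TensorPolytope.specMoment_ne_uniformPoint hN h0
    (TensorPolytope.exists_contract_eq_zero_of_mem_closure_orbit hn hS) h
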